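/- Let $K$ be a field; all abelian and triangulated categories and all exact functors are $K$-linear. For an abelian category $\mathcal{A}$, let $D^b(\mathcal{A})$ be its bounded derived category, and regard $\mathcal{A}$ as a full subcategory of $D^b(\mathcal{A})$ by viewing objects as complexes concentrated in degree $0$. Let $\mathcal{A}$ and $\mathcal{B}$ be abelian categories such that: (a) $\operatorname{Hom}_{\mathcal{A}}(A,A')$ is a finite-dimensional $K$-vector space for all objects $A,A'$ of $\mathcal{A}$; (b) $\mathcal{A}$ is of finite homological dimension, i.e. there is an integer $l$ such that $\operatorname{Hom}_{D^b(\mathcal{A})}(A,A'[i])=0$ for all $i>l$ and all objects $A,A'$ of $\mathcal{A}$; (c) $\mathcal{A}$ has an ample sequence, i.e. a family $\{P_i\}_{i\in\mathbb{Z}}$ of objects of $\mathcal{A}$ such that for every object $C$ of $\mathcal{A}$ there is an integer $i(C)$ such that, for all $i\le i(C)$: (1) the natural morphism $\operatorname{Hom}_{\mathcal{A}}(P_i,C)\otimes_K P_i\to C$ is an epimorphism; (2) $\operatorname{Hom}_{D^b(\mathcal{A})}(P_i,C[j])=0$ for all $j\ne 0$; (3) $\operatorname{Hom}_{\mathcal{A}}(C,P_i)=0$.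 Let $F:D^b(\mathcal{A})\to D^b(\mathcal{B})$ be an exact functor which has a left adjoint and satisfies $F(\mathcal{A})\subseteq\mathcal{B}$, i.e. for every object $A$ of $\mathcal{A}$ the object $F(A)$ is isomorphic to an object of $\mathcal{B}$. Then the restriction $G:=F|_{\mathcal{A}}:\mathcal{A}\to\mathcal{B}$ is an exact functor, and there is an isomorphism of functors $D^b(G)\cong F$, where $D^b(G):D^b(\mathcal{A})\to D^b(\mathcal{B})$ is the functor induced by $G$, i.e. obtained by applying $G$ termwise to complexes. -/

import Mathlib

open CategoryTheory CategoryTheory.Limits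

universe u₀ w₁ w₂ v₁ v₂ u₁ u₂

namespace BoundedDerived

noncomputable section

section Basic

variable (C : Type u₁) [Category.{v₁} C] [Abelian C] [HasDerivedCategory.{w₁} C]

/-- The inclusion `C ⥤ D^b(C)` of an abelian category in its bounded derived category:
an object is sent to the complex concentrated in degree `0`. -/
def incl : C ⥤ DerivedCategory.Bounded C :=
  (DerivedCategory.TStructure.t (C := C)).bounded.lift (DerivedCategory.singleFunctor C 0)
    (fun _ => ⟨⟨0, inferInstance⟩, ⟨0, inferInstance⟩⟩)

instance : (incl C).Full :=
  Functor.Full.of_comp_faithful_iso (G := DerivedCategory.Bounded.ι)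
    (H := DerivedCategory.singleFunctor C 0) (Iso.refl _)

instance : (incl C).Faithful :=
  Functor.Faithful.of_comp_iso (G := DerivedCategory.Bounded.ι)
    (H := DerivedCategory.singleFunctor C 0) (Iso.refl _)

/-- `C` is of finite homological dimension: there is an integer `l` such that
`Hom_{D^b(C)}(X, Y[i]) = 0` for all `i > l` and all objects `X`, `Y` of `C`. -/
def FiniteHomologicalDimension : Prop :=
  ∃ l : ℤ, ∀ i : ℤ, l < i → ∀ (X Y : C) (f : (incl C).obj X ⟶ ((incl C).obj Y)⟦i⟧), f = 0

end Basic

section Ample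

variable (K : Type u₀) [Field K] {C : Type u₁} [Category.{v₁} C] [Abelian C] [Linear K C]
  [∀ X Y : C, Module.Finite K (X ⟶ Y)]

/-- The natural morphism `Hom(P, B) ⊗ P ⟶ B`. A basis `e₁, …, eₙ` of the finite dimensional
vector space `Hom(P, B)` identifies `Hom(P, B) ⊗ P` with `P^{⊕ n}`, and the natural morphism
with the morphism which is `e_k` on the `k`-th summand. -/
def evalMorphism (P B : C) :
    (∐ fun _ : Fin (Module.finrank K (P ⟶ B)) => P) ⟶ B :=
  Sigma.desc fun k => Module.finBasis K (P ⟶ B) k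

/-- Ample sequences `(P_i)_{i ∈ ℤ}` in an abelian category with finite dimensional `Hom`s. -/
def IsAmpleSequence [HasDerivedCategory.{w₁} C] (P : ℤ → C) : Prop :=
  ∀ B : C, ∃ i₀ : ℤ, ∀ i : ℤ, i ≤ i₀ →
    Epi (evalMorphism K (P i) B) ∧
    (∀ j : ℤ, j ≠ 0 → ∀ f : (incl C).obj (P i) ⟶ ((incl C).obj B)⟦j⟧, f = 0) ∧
    (∀ f : B ⟶ P i, f = 0)

end Ample

section Functors

variable {C₁ : Type u₁} [Category.{v₁} C₁] [Abelian C₁] [HasDerivedCategory.{w₁} C₁]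
  {C₂ : Type u₂} [Category.{v₂} C₂] [Abelian C₂] [HasDerivedCategory.{w₂} C₂]

lemma bounded_mapDerivedCategory_obj (G : C₁ ⥤ C₂) [G.Additive] [PreservesFiniteLimits G]
    [PreservesFiniteColimits G] (X : DerivedCategory.Bounded C₁) :
    (DerivedCategory.TStructure.t (C := C₂)).bounded (G.mapDerivedCategory.obj X.obj) := by
  obtain ⟨X, ⟨a, ha⟩, ⟨b, hb⟩⟩ := X
  obtain ⟨L, hL₁, hL₂, ⟨e⟩⟩ := X.exists_iso_Q_obj_of_isGE_of_isLE a b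
  let e' := G.mapDerivedCategory.mapIso e ≪≫ G.mapDerivedCategoryFactors.app L
  exact ⟨⟨a, ⟨⟨_, e', inferInstance⟩⟩⟩, ⟨b, ⟨⟨_, e', inferInstance⟩⟩⟩⟩

/-- The functor `D^b(G) : D^b(C₁) ⥤ D^b(C₂)` induced by an exact functor `G : C₁ ⥤ C₂`:
the restriction of `D(G) : D(C₁) ⥤ D(C₂)`, which applies `G` to complexes termwise. -/
def mapBounded (G : C₁ ⥤ C₂) [G.Additive] [PreservesFiniteLimits G]
    [PreservesFiniteColimits G] : DerivedCategory.Bounded C₁ ⥤ DerivedCategory.Bounded C₂ :=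
  (DerivedCategory.TStructure.t (C := C₂)).bounded.lift
    (DerivedCategory.Bounded.ι ⋙ G.mapDerivedCategory) (bounded_mapDerivedCategory_obj G)

/-- `F(C₁) ⊆ C₂`: the functor `F` sends every object of `C₁` to (an object isomorphic to)
an object of `C₂`. -/
def MapsHeart (F : DerivedCategory.Bounded C₁ ⥤ DerivedCategory.Bounded C₂) : Prop :=
  ∀ X : C₁, (incl C₂).essImage (F.obj ((incl C₁).obj X))

/-- The restriction `F|_{C₁} : C₁ ⥤ C₂` of a functor `F : D^b(C₁) ⥤ D^b(C₂)` such that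
`F(C₁) ⊆ C₂`. -/
def restriction (F : DerivedCategory.Bounded C₁ ⥤ DerivedCategory.Bounded C₂)
    (hF : MapsHeart F) : C₁ ⥤ C₂ :=
  Functor.essImage.liftFunctor (incl C₁ ⋙ F) (incl C₂) hF

/-- The restriction is, up to isomorphism, the only functor that is compatible with `F` and
the inclusions `C₁ ⥤ D^b(C₁)` and `C₂ ⥤ D^b(C₂)`. -/
def restrictionCompInclIso (F : DerivedCategory.Bounded C₁ ⥤ DerivedCategory.Bounded C₂)
    (hF : MapsHeart F) : restriction F hF ⋙ incl C₂ ≅ incl C₁ ⋙ F :=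
  Functor.essImage.liftFunctorCompIso (incl C₁ ⋙ F) (incl C₂) hF

end Functors

end

end BoundedDerived

/-! On the heart, `F` and the derived functor of `G` agree by construction; the problem is to spread
this isomorphism over all amplitudes `[a, b]`, although cones are not functorial. Let `X` have
amplitude `[a, c]` with `c = b + 1`. For `i ≪ 0` a finite sum `P` of copies of `P_i` covers the top
cohomology of `X`; by ampleness (2) the cover lifts to `P[-c] ⟶ X`, and its cone `Z` has amplitude
`[a, b]`. As `P[1-c]` sits in degree `b`, the isomorphism is known at `Z` and at `P[1-c]`, and
completing a morphism of triangles gives one at `X`.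

Independence of choices and naturality rest on one vanishing, `IsSeparating`. If `L` is left adjoint
to `F`, then `Hom(FX, F(P[-c])) = Hom(LFX, P[-c])`. Since `F` is t-exact, `LFX` is `≤ c`, so only
maps from its top cohomology to `P` matter, and ampleness (3) kills them for `i ≪ 0`. Hence a map
`FX ⟶ FY` is determined by its composites with the images of maps from `Y` to objects of amplitude
`[a, b]` (`IsSeparating.eq_zero`). This drives `LocalIso.exists_extension_app`,
`LocalIso.exists_extension` and, for gluing over growing intervals, `LocalIso.app_eq`. -/

namespace BoundedDerived

open Category Pretriangulated Triangulated Preadditive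

/-! ### Natural isomorphisms defined on part of a category -/

section LocalIso

variable {D T : Type*} [Category* D] [Category* T]

/-- A natural isomorphism between the restrictions of two functors to the objects satisfying a
property `S`. -/
structure LocalIso (Φ Φ' : D ⥤ T) (S : ObjectProperty D) where
  /-- the components -/
  app (X : D) (hX : S X) : Φ.obj X ≅ Φ'.obj X
  naturality {X Y : D} (hX : S X) (hY : S Y) (φ : X ⟶ Y) :
    Φ.map φ ≫ (app Y hY).hom = (app X hX).hom ≫ Φ'.map φ

/-- An isomorphism between two functors after precomposition with a full functor `J` gives a
natural isomorphism on the essential image of `J`. -/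
noncomputable def LocalIso.ofEssImage {A : Type*} [Category* A] {Φ Φ' : D ⥤ T} (J : A ⥤ D)
    [J.Full] (σ : J ⋙ Φ ≅ J ⋙ Φ') (S : ObjectProperty D) (hS : S ≤ J.essImage) :
    LocalIso Φ Φ' S where
  app X hX := Φ.mapIso (Functor.essImage.getIso (hS X hX)).symm ≪≫ σ.app _ ≪≫
    Φ'.mapIso (Functor.essImage.getIso (hS X hX))
  naturality {X Y} hX hY φ := by
    obtain ⟨ψ, hψ⟩ := J.map_surjective ((Functor.essImage.getIso (hS X hX)).hom ≫ φ ≫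
      (Functor.essImage.getIso (hS Y hY)).inv)
    have h := σ.hom.naturality ψ
    simp only [Functor.comp_map, hψ, Functor.map_comp, assoc] at h
    simp only [Iso.trans_hom, Functor.mapIso_hom, Iso.symm_hom, Iso.app_hom, assoc]
    rw [← cancel_epi (Φ.map (Functor.essImage.getIso (hS X hX)).hom), reassoc_of% h]
    simp [← Functor.map_comp, ← Functor.map_comp_assoc]

/-- The restriction to a smaller class of objects. -/
def LocalIso.restrict {Φ Φ' : D ⥤ T} {S S' : ObjectProperty D} (f : LocalIso Φ Φ' S)
    (h : S' ≤ S) : LocalIso Φ Φ' S' where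
  app X hX := f.app X (h X hX)
  naturality hX hY φ := f.naturality (h _ hX) (h _ hY) φ

variable [HasShift D ℤ] [HasShift T ℤ]

/-- The natural isomorphism on `S'` deduced by shifting from a natural isomorphism on `S`,
when `S` contains the shift by `n` of all the objects in `S'`. -/
noncomputable def LocalIso.unshift {Φ Φ' : D ⥤ T} [Φ.CommShift ℤ] [Φ'.CommShift ℤ]
    {S : ObjectProperty D} (f : LocalIso Φ Φ' S) (n : ℤ) {S' : ObjectProperty D}
    (h : ∀ X, S' X → S (X⟦n⟧)) : LocalIso Φ Φ' S' where
  app X hX := (shiftFunctor T n).preimageIso ((Φ.commShiftIso n).symm.app X ≪≫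
    f.app (X⟦n⟧) (h X hX) ≪≫ (Φ'.commShiftIso n).app X)
  naturality {X Y} hX hY φ := (shiftFunctor T n).map_injective (by
    have := f.naturality (h X hX) (h Y hY) (φ⟦n⟧')
    simp only [Functor.map_comp, Functor.preimageIso_hom, Functor.map_preimage]
    simp only [Iso.trans_hom, Iso.app_hom, Iso.symm_hom, Functor.commShiftIso_inv_naturality_assoc,
      reassoc_of% this, assoc]
    simp)

lemma LocalIso.unshift_app {Φ Φ' : D ⥤ T} [Φ.CommShift ℤ] [Φ'.CommShift ℤ]
    {S : ObjectProperty D} (f : LocalIso Φ Φ' S) (n : ℤ) {S' : ObjectProperty D}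
    (h : ∀ X, S' X → S (X⟦n⟧)) (X : D) (hX : S' X) :
    (f.app (X⟦n⟧) (h X hX)).hom = (Φ.commShiftIso n).hom.app X ≫
      ((f.unshift n h).app X hX).hom⟦n⟧' ≫ (Φ'.commShiftIso n).inv.app X := by
  simp [unshift]

end LocalIso

/-! ### Exact sequences and morphisms of distinguished triangles -/

section Triangles

variable {D : Type*} [Category* D] [HasZeroObject D] [Preadditive D] [HasShift D ℤ]
  [∀ n : ℤ, (shiftFunctor D n).Additive] [Pretriangulated D]

variable {X₁ X₂ X₃ : D} {f : X₁ ⟶ X₂} {g : X₂ ⟶ X₃} {h : X₃ ⟶ X₁⟦(1 : ℤ)⟧}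
  (hT : Triangle.mk f g h ∈ distTriang D)

include hT

lemma distTriang_desc₂ {Y : D} (u : X₂ ⟶ Y) (hu : f ≫ u = 0) : ∃ v, g ≫ v = u := by
  obtain ⟨v, hv⟩ := Triangle.yoneda_exact₂ _ hT u hu
  exact ⟨v, hv.symm⟩

lemma distTriang_desc₃ {Y : D} (u : X₃ ⟶ Y) (hu : g ≫ u = 0) : ∃ v, h ≫ v = u := by
  obtain ⟨v, hv⟩ := Triangle.yoneda_exact₃ _ hT u hu
  exact ⟨v, hv.symm⟩

lemma distTriang_lift₂ {Y : D} (u : Y ⟶ X₂) (hu : u ≫ g = 0) : ∃ v, v ≫ f = u := by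
  obtain ⟨v, hv⟩ := Triangle.coyoneda_exact₂ _ hT u hu
  exact ⟨v, hv.symm⟩

lemma distTriang_rotate : Triangle.mk g h (-f⟦(1 : ℤ)⟧') ∈ distTriang D :=
  rot_of_distTriang _ hT

lemma distTriang_of_iso₂ {Y : D} (e : X₂ ≅ Y) :
    Triangle.mk (f ≫ e.hom) (e.inv ≫ g) h ∈ distTriang D :=
  isomorphic_distinguished _ hT _ (Triangle.isoMk _ _ (Iso.refl X₁) e.symm (Iso.refl X₃)
    (show (f ≫ e.hom) ≫ e.inv = 𝟙 X₁ ≫ f by simp)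
    (show (e.inv ≫ g) ≫ 𝟙 X₃ = e.inv ≫ g by simp)
    (show h ≫ (𝟙 X₁)⟦(1 : ℤ)⟧' = 𝟙 X₃ ≫ h by simp))

lemma exists_distTriang_shift (n : ℤ) :
    ∃ (f' : X₁⟦n⟧ ⟶ X₂⟦n⟧) (g' : X₂⟦n⟧ ⟶ X₃⟦n⟧) (h' : X₃⟦n⟧ ⟶ (X₁⟦n⟧)⟦(1 : ℤ)⟧),
      Triangle.mk f' g' h' ∈ distTriang D :=
  ⟨_, _, _, Triangle.shift_distinguished _ hT n⟩

lemma distTriang_map {T : Type*} [Category* T] [HasZeroObject T] [Preadditive T] [HasShift T ℤ]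
    [∀ n : ℤ, (shiftFunctor T n).Additive] [Pretriangulated T] (Φ : D ⥤ T) [Φ.CommShift ℤ]
    [Φ.IsTriangulated] :
    Triangle.mk (Φ.map f) (Φ.map g) (Φ.map h ≫ (Φ.commShiftIso (1 : ℤ)).hom.app X₁) ∈
      distTriang T :=
  Φ.map_distinguished _ hT

variable {Y₁ Y₂ Y₃ : D} {f' : Y₁ ⟶ Y₂} {g' : Y₂ ⟶ Y₃} {h' : Y₃ ⟶ Y₁⟦(1 : ℤ)⟧}
  (hT' : Triangle.mk f' g' h' ∈ distTriang D)

include hT'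

lemma distTriang_hom₃ (a : X₁ ⟶ Y₁) (b : X₂ ⟶ Y₂) (comm : f ≫ b = a ≫ f') :
    ∃ c : X₃ ⟶ Y₃, g ≫ c = b ≫ g' ∧ h ≫ a⟦(1 : ℤ)⟧' = c ≫ h' :=
  complete_distinguished_triangle_morphism _ _ hT hT' a b comm

lemma distTriang_iso₁ (b : X₂ ≅ Y₂) (c : X₃ ≅ Y₃) (comm : g ≫ c.hom = b.hom ≫ g') :
    ∃ a : X₁ ≅ Y₁, f ≫ b.hom = a.hom ≫ f' := by
  obtain ⟨a, h₁, h₂⟩ := complete_distinguished_triangle_morphism₁ _ _ hT hT' b.hom c.hom comm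
  have ha : IsIso a := isIso₁_of_isIso₂₃ (Triangle.homMk _ _ a b.hom c.hom h₁ comm h₂) hT hT'
    (inferInstanceAs (IsIso b.hom)) (inferInstanceAs (IsIso c.hom))
  exact ⟨@asIso _ _ _ _ a ha, h₁⟩

end Triangles

/-! ### Objects of bounded amplitude -/

section Interval

variable {D : Type*} [Category* D] [HasZeroObject D] [Preadditive D] [HasShift D ℤ]
  [∀ n : ℤ, (shiftFunctor D n).Additive] [Pretriangulated D]

/-- The objects which are both `≥ a` and `≤ b` for a t-structure. -/
def interval (t : TStructure D) (a b : ℤ) : ObjectProperty D :=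
  fun X => t.IsGE X a ∧ t.IsLE X b

variable {t : TStructure D}

lemma interval.mono {a b a' b' : ℤ} {X : D} (h : interval t a b X) (ha : a' ≤ a) (hb : b ≤ b') :
    interval t a' b' X :=
  have := h.1
  have := h.2
  ⟨t.isGE_of_ge X a' a ha, t.isLE_of_le X b b' hb⟩

lemma interval.shift {a b : ℤ} {X : D} (h : interval t a b X) (n : ℤ) {a' b' : ℤ}
    (ha : n + a' = a) (hb : n + b' = b) : interval t a' b' (X⟦n⟧) :=
  have := h.1
  have := h.2
  ⟨t.isGE_shift X a n a' ha, t.isLE_shift X b n b' hb⟩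

lemma interval.of_iso {a b : ℤ} {X Y : D} (h : interval t a b X) (e : X ≅ Y) :
    interval t a b Y :=
  have := h.1
  have := h.2
  ⟨t.isGE_of_iso e a, t.isLE_of_iso e b⟩

lemma interval.of_distTriang {a b : ℤ} {X₁ X₂ X₃ : D} {f : X₁ ⟶ X₂} {g : X₂ ⟶ X₃}
    {h : X₃ ⟶ X₁⟦(1 : ℤ)⟧} (hT : Triangle.mk f g h ∈ distTriang D)
    (h₁ : interval t a b X₁) (h₃ : interval t a b X₃) : interval t a b X₂ :=
  ⟨t.isGE₂ _ hT a h₁.1 h₃.1, t.isLE₂ _ hT b h₁.2 h₃.2⟩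

end Interval

/-! ### Compatibility with classes in Ext¹ -/

section Connecting

variable {D T : Type*} [Category* D] [HasZeroObject D] [Preadditive D] [HasShift D ℤ]
  [∀ n : ℤ, (shiftFunctor D n).Additive] [Pretriangulated D]
  [Category* T] [HasZeroObject T] [Preadditive T] [HasShift T ℤ]
  [∀ n : ℤ, (shiftFunctor T n).Additive] [Pretriangulated T]
  {t : TStructure D} {Φ Φ' : D ⥤ T} [Φ.CommShift ℤ] [Φ'.CommShift ℤ]

/-- A natural isomorphism on the heart is compatible with connecting morphisms. -/
lemma LocalIso.comm_connecting [Φ.IsTriangulated] [Φ'.IsTriangulated]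
    (f : LocalIso Φ Φ' (interval t 0 0))
    (hW : ∀ X Y, interval t 0 0 X → interval t 0 0 Y → ∀ l : (Φ.obj X)⟦(1 : ℤ)⟧ ⟶ Φ'.obj Y, l = 0)
    {X Y : D} (hX : interval t 0 0 X) (hY : interval t 0 0 Y) (δ : X ⟶ Y⟦(1 : ℤ)⟧) :
    Φ.map δ ≫ (Φ.commShiftIso (1 : ℤ)).hom.app Y ≫ (f.app Y hY).hom⟦1⟧' =
      (f.app X hX).hom ≫ Φ'.map δ ≫ (Φ'.commShiftIso (1 : ℤ)).hom.app Y := by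
  -- `δ` classifies an extension `E` of `X` by `Y`; it lies in the heart, so `f` is defined at `E`.
  obtain ⟨E, i, p, hT⟩ := distinguished_cocone_triangle₂ δ
  have hE := interval.of_distTriang hT hY hX
  obtain ⟨g, hg₁, hg₂⟩ := distTriang_hom₃ (distTriang_map hT Φ) (distTriang_map hT Φ')
    (f.app Y hY).hom (f.app E hE).hom (f.naturality hY hE i)
  have hg : g = (f.app X hX).hom := by
    rw [← sub_eq_zero]
    -- Both candidates for the third component agree after `Φ.map p`, so they differ by a map out of
    -- `(Φ.obj Y)⟦1⟧`, which `hW` kills.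
    obtain ⟨l, hl⟩ := distTriang_desc₃ (distTriang_map hT Φ) (g - (f.app X hX).hom) (by
      rw [comp_sub, sub_eq_zero, hg₁, f.naturality hE hX p])
    rw [← hl, hW _ _ hY hX l, comp_zero]
  subst hg
  simpa using hg₂

/-- The natural isomorphism on the objects concentrated in degree `n` which is deduced from a
natural isomorphism on the heart. -/
noncomputable def LocalIso.heartShift (f : LocalIso Φ Φ' (interval t 0 0)) (n : ℤ) :
    LocalIso Φ Φ' (interval t n n) :=
  f.unshift n fun _ hX => hX.shift n (by simp) (by simp)

/-- Shifting by `c` turns `u` into a class `X⟦c⟧ ⟶ Z⟦b⟧⟦1⟧` in Ext¹ of the heart, where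
`LocalIso.comm_connecting` applies. The rest is coherence of the shifts by `b`, `1` and `c`. -/
lemma LocalIso.heartShift_naturality [Φ.IsTriangulated] [Φ'.IsTriangulated]
    (f : LocalIso Φ Φ' (interval t 0 0))
    (hW : ∀ X Y, interval t 0 0 X → interval t 0 0 Y → ∀ l : (Φ.obj X)⟦(1 : ℤ)⟧ ⟶ Φ'.obj Y, l = 0)
    {b c : ℤ} (hbc : b + 1 = c) {X Z : D} (hX : interval t c c X) (hZ : interval t b b Z)
    (u : X ⟶ Z) :
    Φ.map u ≫ ((f.heartShift b).app Z hZ).hom = ((f.heartShift c).app X hX).hom ≫ Φ'.map u := by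
  have key := f.comm_connecting hW (hX.shift c (a' := 0) (b' := 0) (by simp) (by simp))
    (hZ.shift b (a' := 0) (b' := 0) (by simp) (by simp))
    (u⟦c⟧' ≫ (shiftFunctorAdd' D b 1 c hbc).hom.app Z)
  rw [LocalIso.unshift_app f b (fun _ hX => hX.shift b (by simp) (by simp)) Z hZ,
    LocalIso.unshift_app f c (fun _ hX => hX.shift c (by simp) (by simp)) X hX] at key
  change _ ≫ _ ≫ (_ ≫ ((f.heartShift b).app Z hZ).hom⟦b⟧' ≫ _)⟦1⟧' =
    (_ ≫ ((f.heartShift c).app X hX).hom⟦c⟧' ≫ _) ≫ _ at key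
  have h₁ : Φ.map ((shiftFunctorAdd' D b 1 c hbc).hom.app Z) ≫
      (Φ.commShiftIso (1 : ℤ)).hom.app (Z⟦b⟧) ≫ ((Φ.commShiftIso b).hom.app Z)⟦(1 : ℤ)⟧' =
      (Φ.commShiftIso c).hom.app Z ≫ (shiftFunctorAdd' T b 1 c hbc).hom.app _ := by
    rw [Φ.commShiftIso_add' hbc, Functor.CommShift.isoAdd'_hom_app]
    simp
  have h₂ : Φ'.map ((shiftFunctorAdd' D b 1 c hbc).hom.app Z) ≫
      (Φ'.commShiftIso (1 : ℤ)).hom.app (Z⟦b⟧) ≫ ((Φ'.commShiftIso b).hom.app Z)⟦(1 : ℤ)⟧' =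
      (Φ'.commShiftIso c).hom.app Z ≫ (shiftFunctorAdd' T b 1 c hbc).hom.app _ := by
    rw [Φ'.commShiftIso_add' hbc, Functor.CommShift.isoAdd'_hom_app]
    simp
  apply (shiftFunctor T c).map_injective
  rw [← cancel_epi ((Φ.commShiftIso c).hom.app X),
    ← cancel_mono ((shiftFunctorAdd' T b 1 c hbc).hom.app _)]
  have key' := key =≫ ((Φ'.commShiftIso b).hom.app Z)⟦(1 : ℤ)⟧'
  simp only [Functor.map_comp, assoc] at key'
  rw [reassoc_of% h₁, h₂] at key'
  have h₃ := (shiftFunctorAdd' T b 1 c hbc).hom.naturality ((f.heartShift b).app Z hZ).hom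
  have h₄ : ((Φ'.commShiftIso b).inv.app Z)⟦(1 : ℤ)⟧' ≫ ((Φ'.commShiftIso b).hom.app Z)⟦(1 : ℤ)⟧' =
      𝟙 (((Φ'.obj Z)⟦b⟧)⟦(1 : ℤ)⟧) := by
    rw [← Functor.map_comp, Iso.inv_hom_id_app]
    exact CategoryTheory.Functor.map_id _ _
  rw [h₄, comp_id, Φ.commShiftIso_hom_naturality_assoc, Φ'.commShiftIso_hom_naturality_assoc,
    Iso.inv_hom_id_app_assoc] at key'
  simp only [Functor.map_comp, assoc]
  rw [h₃]
  exact key'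

end Connecting

/-! ### Extending the isomorphism one degree at a time -/

section Extension

variable {D T : Type*} [Category* D] [HasZeroObject D] [Preadditive D] [HasShift D ℤ]
  [∀ n : ℤ, (shiftFunctor D n).Additive] [Pretriangulated D]
  [Category* T] [HasZeroObject T] [Preadditive T] [HasShift T ℤ]
  [∀ n : ℤ, (shiftFunctor T n).Additive] [Pretriangulated T]

/-- A family of classes of objects in the heart of a t-structure such that any bounded object
is approximated in its top degree by an object in the `i`th class for any `i ≪ 0`, and has no
negative extension by such objects. -/
structure IsResolving (t : TStructure D) (Q : ℤ → ObjectProperty D) : Prop where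
  mem_heart (i : ℤ) (P : D) : Q i P → interval t 0 0 P
  exists_triangle {a b c : ℤ} (hab : a ≤ b) (hbc : b + 1 = c) {X : D} (hX : interval t a c X) :
    ∀ᶠ i in Filter.atBot, ∃ (P Z : D) (u : P⟦-c⟧ ⟶ X) (v : X ⟶ Z) (w : Z ⟶ (P⟦-c⟧)⟦(1 : ℤ)⟧),
      Q i P ∧ interval t a b Z ∧ Triangle.mk u v w ∈ distTriang D
  hom_eq_zero {a b c : ℤ} (hbc : b + 1 = c) {Z : D} (hZ : interval t a b Z) :
    ∀ᶠ i in Filter.atBot, ∀ P, Q i P → ∀ l : P⟦-c⟧ ⟶ Z, l = 0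

/-- There are no nonzero morphisms from the image by `Φ` of an object which is `≤ c` to the
image by `Φ'` of an object of the `i`th class placed in degree `c` for `i ≪ 0`. -/
def IsSeparating (t : TStructure D) (Q : ℤ → ObjectProperty D) (Φ Φ' : D ⥤ T) : Prop :=
  ∀ ⦃a c : ℤ⦄ ⦃X : D⦄, interval t a c X → ∀ᶠ i in Filter.atBot, ∀ P, Q i P →
    ∀ l : Φ.obj X ⟶ Φ'.obj (P⟦-c⟧), l = 0

variable {t : TStructure D} {Q : ℤ → ObjectProperty D} {Φ Φ' : D ⥤ T}
  [Φ'.CommShift ℤ] [Φ'.IsTriangulated]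

/-- In a triangle `P[-c] ⟶ Y ⟶ Z`, the hypothesis makes `h` factor through `Φ'(P[-c])`, and for `i ≪
0` no nonzero map from `Φ X` arrives there. -/
lemma IsSeparating.eq_zero (hQ : IsResolving t Q) (hV : IsSeparating t Q Φ Φ')
    {a b c : ℤ} (hab : a ≤ b) (hbc : b + 1 = c)
    {X Y : D} (hX : interval t a c X) (hY : interval t a c Y) (h : Φ.obj X ⟶ Φ'.obj Y)
    (hh : ∀ Z, interval t a b Z → ∀ u : Y ⟶ Z, h ≫ Φ'.map u = 0) : h = 0 := by
  obtain ⟨i, ⟨P, Z, u, v, w, hP, hZ, hT⟩, hl⟩ :=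
    ((hQ.exists_triangle hab hbc hY).and (hV hX)).exists
  obtain ⟨l, rfl⟩ := distTriang_lift₂ (distTriang_map hT Φ') h (hh Z hZ v)
  rw [hl P hP l, zero_comp]

/-- Induction on the top degree: by naturality, two isomorphisms that agree one degree lower have
equal composites to all test objects, so `IsSeparating.eq_zero` applies to their difference. -/
lemma LocalIso.app_eq (hQ : IsResolving t Q) (hV : IsSeparating t Q Φ Φ') {a : ℤ} (n : ℕ)
    {b : ℤ} (hb : a + n = b) (f g : LocalIso Φ Φ' (interval t a b))
    (h : ∀ X (hX : interval t a b X), interval t a a X → f.app X hX = g.app X hX)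
    (X : D) (hX : interval t a b X) : f.app X hX = g.app X hX := by
  induction n generalizing b X with
  | zero => exact h X hX (by simpa [← hb] using hX)
  | succ n ih =>
    push_cast at hb
    have hle : interval t a (a + n) ≤ interval t a b := fun Y hY => hY.mono le_rfl (by lia)
    ext
    rw [← sub_eq_zero]
    refine hV.eq_zero hQ (by lia) (show a + n + 1 = b by lia) hX hX _ fun Z hZ u => ?_
    have := ih rfl (f.restrict hle) (g.restrict hle) (fun Y hY hY' => h Y (hle Y hY) hY') Z hZ
    change f.app Z (hle Z hZ) = g.app Z (hle Z hZ) at this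
    rw [sub_comp, ← f.naturality hX (hle Z hZ), ← g.naturality hX (hle Z hZ), this, sub_self]

variable [Φ.CommShift ℤ] [Φ.IsTriangulated]

lemma LocalIso.exists_approximation (hQ : IsResolving t Q)
    {a b c : ℤ} (hab : a ≤ b) (hbc : b + 1 = c) (f : LocalIso Φ Φ' (interval t a b))
    {X : D} (hX : interval t a c X) :
    ∀ᶠ i in Filter.atBot, ∃ (P Z : D) (u : P⟦-c⟧ ⟶ X) (v : X ⟶ Z) (w : Z ⟶ (P⟦-c⟧)⟦(1 : ℤ)⟧)
      (hZ : interval t a b Z) (g : Φ.obj X ≅ Φ'.obj X),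
      Q i P ∧ Triangle.mk u v w ∈ distTriang D ∧
        Φ.map v ≫ (f.app Z hZ).hom = g.hom ≫ Φ'.map v := by
  filter_upwards [hQ.exists_triangle hab hbc hX] with i ⟨P, Z, u, v, w, hP, hZ, hT⟩
  have hP' : interval t a b ((P⟦-c⟧)⟦(1 : ℤ)⟧) :=
    (((hQ.mem_heart i P hP).shift (-c) (a' := c) (b' := c) (by simp) (by simp)).shift 1
      (a' := b) (b' := b) (by lia) (by lia)).mono hab le_rfl
  have hT' := distTriang_rotate hT
  obtain ⟨g, hg⟩ := distTriang_iso₁ (distTriang_map hT' Φ) (distTriang_map hT' Φ')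
    (f.app Z hZ) (f.app _ hP') (f.naturality hZ hP' w)
  exact ⟨P, Z, u, v, w, hZ, g, hP, hT, hg⟩

/-- The isomorphism `g₀` comes from one approximation `Z₀` of `X`. Given `v`, a second approximation
`Z₁` with much smaller `i` is chosen so that both `v` and `v₀` factor through `Z₁`; its isomorphism
`g₁` is then compatible with both. Thus `g₀ - g₁` dies in `Φ' Z₀`, and separation forces `g₀ = g₁`.
-/
lemma LocalIso.exists_extension_app (hQ : IsResolving t Q) (hV : IsSeparating t Q Φ Φ')
    {a b c : ℤ} (hab : a ≤ b) (hbc : b + 1 = c) (f : LocalIso Φ Φ' (interval t a b))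
    {X : D} (hX : interval t a c X) :
    ∃ g : Φ.obj X ≅ Φ'.obj X, ∀ (Z : D) (hZ : interval t a b Z) (v : X ⟶ Z),
      Φ.map v ≫ (f.app Z hZ).hom = g.hom ≫ Φ'.map v := by
  obtain ⟨i₀, ⟨P₀, Z₀, u₀, v₀, w₀, hZ₀, g₀, hP₀, hT₀, hg₀⟩, hl₀⟩ :=
    ((f.exists_approximation hQ hab hbc hX).and (hV hX)).exists
  refine ⟨g₀, fun Z hZ v => ?_⟩
  obtain ⟨i, ⟨P₁, Z₁, u₁, v₁, w₁, hZ₁, g₁, hP₁, hT₁, hg₁⟩, hz₀, hz⟩ :=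
    ((f.exists_approximation hQ hab hbc hX).and
      ((hQ.hom_eq_zero hbc hZ₀).and (hQ.hom_eq_zero hbc hZ))).exists
  have fac : ∀ (W : D) (hW : interval t a b W) (v' : X ⟶ W),
      (∀ l : P₁⟦-c⟧ ⟶ W, l = 0) → Φ.map v' ≫ (f.app W hW).hom = g₁.hom ≫ Φ'.map v' := by
    intro W hW v' hv'
    obtain ⟨q, rfl⟩ := distTriang_desc₂ hT₁ v' (hv' _)
    rw [Functor.map_comp, Functor.map_comp, assoc, f.naturality hZ₁ hW, reassoc_of% hg₁]
  have hg : g₀.hom = g₁.hom := by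
    rw [← sub_eq_zero]
    obtain ⟨l, hl⟩ := distTriang_lift₂ (distTriang_map hT₀ Φ') (g₀.hom - g₁.hom) (by
      rw [sub_comp, ← hg₀, fac Z₀ hZ₀ v₀ (hz₀ P₁ hP₁), sub_self])
    rw [← hl, hl₀ P₀ hP₀ l, zero_comp]
  rw [hg]
  exact fac Z hZ v (hz P₁ hP₁)

lemma LocalIso.exists_extension (hQ : IsResolving t Q) (hV : IsSeparating t Q Φ Φ')
    {a b c : ℤ} (hab : a ≤ b) (hbc : b + 1 = c) (f : LocalIso Φ Φ' (interval t a b)) :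
    ∃ g : LocalIso Φ Φ' (interval t a c),
      ∀ (X : D) (hX : interval t a c X) (Z : D) (hZ : interval t a b Z) (v : X ⟶ Z),
        Φ.map v ≫ (f.app Z hZ).hom = (g.app X hX).hom ≫ Φ'.map v := by
  choose g hg using fun X (hX : interval t a c X) =>
    f.exists_extension_app hQ hV hab hbc hX
  refine ⟨⟨g, fun {X Y} hX hY φ => ?_⟩, hg⟩
  rw [← sub_eq_zero]
  refine hV.eq_zero hQ hab hbc hX hY _ fun Z hZ u => ?_
  rw [sub_comp, assoc, assoc, ← hg Y hY Z hZ, ← Functor.map_comp, ← hg X hX Z hZ,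
    Functor.map_comp, assoc, sub_self]

/-- Agreement with the shifts in each single degree is carried along because it makes the
isomorphisms on different intervals comparable through `LocalIso.app_eq`. -/
lemma LocalIso.exists_interval (hQ : IsResolving t Q) (hV : IsSeparating t Q Φ Φ')
    (f₀ : LocalIso Φ Φ' (interval t 0 0))
    (hW : ∀ X Y, interval t 0 0 X → interval t 0 0 Y → ∀ l : (Φ.obj X)⟦(1 : ℤ)⟧ ⟶ Φ'.obj Y, l = 0)
    (a : ℤ) (n : ℕ) {b : ℤ} (hb : a + n = b) :
    ∃ f : LocalIso Φ Φ' (interval t a b), ∀ (k : ℤ), a ≤ k → k ≤ b → ∀ (X : D)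
      (hX : interval t a b X) (hX' : interval t k k X),
        f.app X hX = (f₀.heartShift k).app X hX' := by
  induction n generalizing b with
  | zero =>
    obtain rfl : a = b := by simpa using hb
    refine ⟨f₀.heartShift a, fun k hk hk' X hX hX' => ?_⟩
    obtain rfl : k = a := le_antisymm hk' hk
    rfl
  | succ n ih =>
    push_cast at hb
    obtain ⟨f, hf⟩ := ih rfl
    have hc : a + n + 1 = b := by lia
    obtain ⟨g, hg⟩ := f.exists_extension hQ hV (by lia) hc
    refine ⟨g, fun k hk hk' X hX hX' => ?_⟩
    ext
    by_cases hkb : k ≤ a + n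
    · have hX'' : interval t a (a + n) X := hX'.mono hk hkb
      have := hg X hX X hX'' (𝟙 X)
      rw [CategoryTheory.Functor.map_id, CategoryTheory.Functor.map_id, id_comp, comp_id] at this
      rw [← this, hf k hk hkb X hX'' hX']
    -- In the new top degree, test objects lie one degree lower, so the comparison is compatibility
    -- with Ext¹ classes.
    · obtain rfl : k = b := by lia
      rw [← sub_eq_zero]
      refine hV.eq_zero hQ le_rfl hc (hX'.mono (by lia) le_rfl) (hX'.mono (by lia) le_rfl) _
        fun Z hZ u => ?_
      have hZ' : interval t a (a + n) Z := hZ.mono (by lia) le_rfl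
      rw [sub_comp, ← hg X hX Z hZ', ← f₀.heartShift_naturality hW hc hX' hZ,
        hf (a + n) (by lia) le_rfl Z hZ' hZ, sub_self]

/-- A natural isomorphism on the heart of a bounded t-structure extends to all objects in the
presence of a resolving family. -/
theorem LocalIso.nonempty_iso (hQ : IsResolving t Q) (hV : IsSeparating t Q Φ Φ')
    (f₀ : LocalIso Φ Φ' (interval t 0 0))
    (hW : ∀ X Y, interval t 0 0 X → interval t 0 0 Y → ∀ l : (Φ.obj X)⟦(1 : ℤ)⟧ ⟶ Φ'.obj Y, l = 0)
    (hD : ∀ X : D, ∃ a b : ℤ, interval t a b X) : Nonempty (Φ ≅ Φ') := by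
  choose f hf using fun n : ℕ =>
    LocalIso.exists_interval hQ hV f₀ hW (-(n : ℤ)) (2 * n) (b := n) (by push_cast; lia)
  have hX : ∀ X : D, ∃ n : ℕ, interval t (-(n : ℤ)) n X := fun X => by
    obtain ⟨a, b, h⟩ := hD X
    exact ⟨a.natAbs + b.natAbs, h.mono (by lia) (by lia)⟩
  choose N hN using hX
  have compat : ∀ {n m : ℕ} (hnm : n ≤ m) (X : D) (h : interval t (-(n : ℤ)) n X)
      (h' : interval t (-(m : ℤ)) m X), (f m).app X h' = (f n).app X h := by
    intro n m hnm X h h'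
    have hle : interval t (-(n : ℤ)) n ≤ interval t (-(m : ℤ)) m :=
      fun Y hY => hY.mono (by lia) (by lia)
    -- In the lowest degree `-n` both are the shift of `f₀`.
    exact LocalIso.app_eq hQ hV (2 * n) (by push_cast; lia) ((f m).restrict hle) (f n)
      (fun Y hY hY' => (hf m _ (by lia) (by lia) Y (hle Y hY) hY').trans
        (hf n _ le_rfl (by lia) Y hY hY').symm) X h
  refine ⟨NatIso.ofComponents (fun X => (f (N X)).app X (hN X)) fun {X Y} φ => ?_⟩
  have hX : interval t (-(max (N X) (N Y) : ℕ) : ℤ) (max (N X) (N Y) : ℕ) X :=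
    (hN X).mono (by lia) (by lia)
  have hY : interval t (-(max (N X) (N Y) : ℕ) : ℤ) (max (N X) (N Y) : ℕ) Y :=
    (hN Y).mono (by lia) (by lia)
  rw [← compat (le_max_left _ _) X (hN X) hX, ← compat (le_max_right _ _) Y (hN Y) hY]
  exact (f _).naturality hX hY φ

end Extension

/-! ### From ample families to resolutions of bounded objects -/

section Resolving

variable {D : Type*} [Category* D] [HasZeroObject D] [Preadditive D] [HasShift D ℤ]
  [∀ n : ℤ, (shiftFunctor D n).Additive] [Pretriangulated D]
  {t : TStructure D}

/-- A family of classes of objects in the heart of a t-structure, such that any object `C` in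
the heart is a quotient in the heart of an object in the `i`th class for any `i ≪ 0`, and such
that the objects in this class have only morphisms of degree `0` to `C`. -/
structure IsAmpleFamily (t : TStructure D) (Q : ℤ → ObjectProperty D) : Prop where
  mem_heart (i : ℤ) (P : D) : Q i P → interval t 0 0 P
  exists_triangle {C : D} (hC : interval t 0 0 C) :
    ∀ᶠ i in Filter.atBot, ∃ (P N : D) (u : P ⟶ C) (v : C ⟶ N) (w : N ⟶ P⟦(1 : ℤ)⟧),
      Q i P ∧ interval t (-1) (-1) N ∧ Triangle.mk u v w ∈ distTriang D
  hom_eq_zero {C : D} (hC : interval t 0 0 C) :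
    ∀ᶠ i in Filter.atBot, ∀ P, Q i P → ∀ j : ℤ, j ≠ 0 → ∀ l : P ⟶ C⟦j⟧, l = 0

variable {Q : ℤ → ObjectProperty D}

lemma IsAmpleFamily.exists_triangle_shift (hQ : IsAmpleFamily t Q) {b c : ℤ} (hbc : b + 1 = c)
    {W : D} (hW : interval t c c W) :
    ∀ᶠ i in Filter.atBot, ∃ (P N : D) (u : P⟦-c⟧ ⟶ W) (v : W ⟶ N) (w : N ⟶ (P⟦-c⟧)⟦(1 : ℤ)⟧),
      Q i P ∧ interval t b b N ∧ Triangle.mk u v w ∈ distTriang D := by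
  filter_upwards [hQ.exists_triangle (hW.shift c (a' := 0) (b' := 0) (by simp) (by simp))]
    with i ⟨P, N, u, v, w, hP, hN, hT⟩
  obtain ⟨u', v', w', hT'⟩ := exists_distTriang_shift hT (-c)
  exact ⟨P, N⟦-c⟧, _, _, _, hP, hN.shift (-c) (by lia) (by lia),
    distTriang_of_iso₂ hT' ((shiftFunctorCompIsoId D c (-c) (by simp)).app W)⟩

variable [IsTriangulated D]

/-- A class of objects which is closed under extensions and contains the objects concentrated
in a degree in `[a, b]` contains all the objects which are `≥ a` and `≤ b`. -/
lemma interval.induction {a b : ℤ} (hab : a ≤ b) (S : ObjectProperty D)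
    (ext : ∀ {X₁ X₂ X₃ : D} {f : X₁ ⟶ X₂} {g : X₂ ⟶ X₃} {h : X₃ ⟶ X₁⟦(1 : ℤ)⟧},
      Triangle.mk f g h ∈ distTriang D → S X₁ → S X₃ → S X₂)
    (single : ∀ k, a ≤ k → k ≤ b → ∀ X, interval t k k X → S X)
    {X : D} (hX : interval t a b X) : S X := by
  obtain ⟨n, hn⟩ := Int.le.dest hab
  induction n generalizing b X with
  | zero =>
    obtain rfl : a = b := by simpa using hn
    exact single a le_rfl le_rfl X hX
  | succ n ih =>
    have := hX.1
    have := hX.2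
    have hb : a + n + 1 = b := by rw [← hn]; push_cast; ring
    refine ext (t.triangleLEGE_distinguished (a + n) b hb X) ?_ ?_
    · exact ih (by lia) (fun k hk hk' => single k hk (by lia))
        ⟨inferInstanceAs (t.IsGE ((t.truncLE (a + n)).obj X) a),
          inferInstanceAs (t.IsLE ((t.truncLE (a + n)).obj X) (a + n))⟩ rfl
    · exact single b hab le_rfl _ ⟨inferInstanceAs (t.IsGE ((t.truncGE b).obj X) b),
        inferInstanceAs (t.IsLE ((t.truncGE b).obj X) b)⟩

lemma IsAmpleFamily.hom_shift_eq_zero (hQ : IsAmpleFamily t Q) {a b c : ℤ} (hbc : b < c) {Z : D}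
    (hZ : interval t a b Z) : ∀ᶠ i in Filter.atBot, ∀ P, Q i P → ∀ l : P⟦-c⟧ ⟶ Z, l = 0 := by
  -- The dévissage needs a nonempty interval; lowering `a` costs nothing.
  refine interval.induction (a := min a b) (min_le_right a b)
    (fun Z => ∀ᶠ i in Filter.atBot, ∀ P, Q i P → ∀ l : P⟦-c⟧ ⟶ Z, l = 0) ?_ ?_
    (hZ.mono (min_le_left a b) le_rfl)
  · intro X₁ X₂ X₃ f g h hT h₁ h₃
    filter_upwards [h₁, h₃] with i h₁ h₃ P hP l
    obtain ⟨l', rfl⟩ := distTriang_lift₂ hT l (h₃ P hP _)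
    rw [h₁ P hP l', zero_comp]
  · intro k _ hk X hX
    filter_upwards [hQ.hom_eq_zero (hX.shift k (a' := 0) (b' := 0) (by simp) (by simp))]
      with i hi P hP l
    apply (shiftFunctor D c).map_injective
    rw [Functor.map_zero]
    have := hi P hP (c - k) (by lia) ((shiftFunctorCompIsoId D (-c) c (by simp)).inv.app P ≫
      l⟦c⟧' ≫ (shiftFunctorAdd' D k (c - k) c (by simp)).hom.app X)
    rwa [← cancel_epi ((shiftFunctorCompIsoId D (-c) c (by simp)).inv.app P),
      ← cancel_mono ((shiftFunctorAdd' D k (c - k) c (by simp)).hom.app X), assoc, comp_zero,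
      zero_comp]

lemma IsAmpleFamily.isResolving (hQ : IsAmpleFamily t Q) : IsResolving t Q where
  mem_heart := hQ.mem_heart
  hom_eq_zero {a b c} hbc Z hZ := hQ.hom_shift_eq_zero (by lia) hZ
  exists_triangle {a b c} hab hbc X hX := by
    have := hX.1
    have := hX.2
    have hY : interval t a b ((t.truncLE b).obj X) := ⟨inferInstance, inferInstance⟩
    have hW : interval t c c ((t.truncGE c).obj X) := ⟨inferInstance, inferInstance⟩
    have hT := distTriang_rotate (t.triangleLEGE_distinguished b c hbc X)
    have hY' := hY.shift 1 (a' := a - 1) (b' := b - 1) (by lia) (by lia)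
    filter_upwards [hQ.exists_triangle_shift hbc hW, hQ.hom_shift_eq_zero (c := c) (by lia) hY']
      with i ⟨P, N, p, q, r, hP, hN, hT'⟩ hi
    -- The obstruction to lifting `p` from the top truncation to `X` lies in `Hom(P[-c], Y[1])`,
    -- which vanishes for `i ≪ 0`. The octahedron then exhibits the cone `Z` as an extension of `N`
    -- by `Y`.
    obtain ⟨u, hu⟩ := distTriang_lift₂ hT p (hi P hP _)
    obtain ⟨Z, v, w, hZ⟩ := distinguished_cocone_triangle u
    have O := someOctahedron hu hZ hT hT'
    refine ⟨P, Z, u, v, w, hP, ?_, hZ⟩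
    exact interval.of_distTriang (inv_rot_of_distTriang _ O.mem)
      ((hY'.shift (-1) (by lia) (by lia))) (hN.mono hab le_rfl)

end Resolving

/-! ### t-exactness, the left adjoint, and separation -/

section Exact

variable {D E T : Type*} [Category* D] [HasZeroObject D] [Preadditive D] [HasShift D ℤ]
  [∀ n : ℤ, (shiftFunctor D n).Additive] [Pretriangulated D] [IsTriangulated D]
  [Category* E] [HasZeroObject E] [Preadditive E] [HasShift E ℤ]
  [∀ n : ℤ, (shiftFunctor E n).Additive] [Pretriangulated E]
  [Category* T] [Preadditive T] [HasShift T ℤ]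
  {t : TStructure D} {s : TStructure E} {F : D ⥤ E} [F.CommShift ℤ] [F.IsTriangulated]

/-- A triangulated functor which sends the heart in the heart is t-exact on bounded objects. -/
lemma interval.map (hF : ∀ X, interval t 0 0 X → interval s 0 0 (F.obj X)) {a b : ℤ}
    (hab : a ≤ b) {X : D} (hX : interval t a b X) : interval s a b (F.obj X) := by
  refine interval.induction hab (fun X => interval s a b (F.obj X))
    (fun hT h₁ h₃ => interval.of_distTriang (distTriang_map hT F) h₁ h₃)
    (fun k hk hk' X hX => ?_) hX
  have h : interval s 0 0 ((F.obj X)⟦k⟧) := (hF _ (hX.shift k (a' := 0) (b' := 0) (by simp) (by simp))).of_iso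
    ((F.commShiftIso k).app X)
  have := h.1
  have := h.2
  have h' : interval s k k (F.obj X) :=
    ⟨s.isGE_of_shift _ k k 0 (by simp), s.isLE_of_shift _ k k 0 (by simp)⟩
  exact h'.mono hk hk'

/-- The left adjoint of a t-exact functor is right t-exact. -/
lemma isLE_leftAdjoint_obj (hF : ∀ X, interval t 0 0 X → interval s 0 0 (F.obj X))
    (hD : ∀ X : D, ∃ a b : ℤ, interval t a b X) {L : E ⥤ D} (adj : L ⊣ F) {Y : E} {b : ℤ}
    (hY : s.IsLE Y b) : t.IsLE (L.obj Y) b := by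
  rw [t.isLE_iff_orthogonal b (b + 1) rfl]
  intro Z f hZ
  obtain ⟨a', b', h⟩ := hD Z
  -- Taking the maximum keeps the interval nonempty, as `interval.map` requires.
  have hZ' : interval t (b + 1) (max b' (b + 1)) Z :=
    ⟨hZ, (h.mono le_rfl (le_max_left b' (b + 1))).2⟩
  have := (hZ'.map hF (le_max_right _ _)).1
  apply (adj.homEquiv _ _).injective
  rw [s.zero (adj.homEquiv _ _ f) b (b + 1) (by lia), s.zero (adj.homEquiv _ _ 0) b (b + 1) (by lia)]

lemma isSeparating_of_isRightAdjoint {Q : ℤ → ObjectProperty D}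
    (hQ : ∀ i P, Q i P → interval t 0 0 P)
    (hQ' : ∀ C, interval t 0 0 C → ∀ᶠ i in Filter.atBot, ∀ P, Q i P → ∀ l : C ⟶ P, l = 0)
    (hD : ∀ X : D, ∃ a b : ℤ, interval t a b X) [F.IsRightAdjoint]
    (hF : ∀ X, interval t 0 0 X → interval s 0 0 (F.obj X))
    (j : E ⥤ T) [j.Full] [j.Faithful] [j.CommShift ℤ] [j.Additive]
    {Φ' : D ⥤ T} [Φ'.CommShift ℤ]
    (f : LocalIso (F ⋙ j) Φ' (interval t 0 0)) : IsSeparating t Q (F ⋙ j) Φ' := by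
  intro a c X hX
  let L := F.leftAdjoint
  let adj : L ⊣ F := Adjunction.ofIsRightAdjoint F
  have hL : t.IsLE (L.obj (F.obj X)) c := isLE_leftAdjoint_obj hF hD adj
    ((hX.mono (min_le_left a c) le_rfl).map hF (min_le_right a c)).2
  have hC : interval t c c ((t.truncGE c).obj (L.obj (F.obj X))) := ⟨inferInstance, inferInstance⟩
  filter_upwards [hQ' _ (hC.shift c (a' := 0) (b' := 0) (by simp) (by simp))] with i hi P hP l
  have hP' : interval t c c (P⟦-c⟧) := (hQ i P hP).shift (-c) (by simp) (by simp)
  have := hP'.1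
  have h₀ : ∀ m : (t.truncGE c).obj (L.obj (F.obj X)) ⟶ P⟦-c⟧, m = 0 := fun m => by
    apply (shiftFunctor D c).map_injective
    rw [← cancel_mono ((shiftFunctorCompIsoId D (-c) c (by simp)).hom.app P), hi P hP (_ ≫ _),
      Functor.map_zero, zero_comp]
  have h₁ : ∀ m : L.obj (F.obj X) ⟶ P⟦-c⟧, m = 0 := fun m => by
    rw [← t.π_descTruncGE m c, h₀ (t.descTruncGE m c), comp_zero]
  have h₂ : ∀ m : F.obj X ⟶ F.obj (P⟦-c⟧), m = 0 := fun m =>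
    (adj.homEquiv _ _).symm.injective ((h₁ _).trans (h₁ _).symm)
  -- At `P[-c]`, which sits in one degree, `Φ'` may be replaced by `F ⋙ j`, so the adjunction
  -- applies.
  rw [← cancel_mono ((f.heartShift c).app _ hP').inv, zero_comp]
  obtain ⟨m, hm⟩ := j.map_surjective (X := F.obj X) (Y := F.obj (P⟦-c⟧))
    (l ≫ ((f.heartShift c).app _ hP').inv)
  exact hm.symm.trans (by rw [h₂ m, Functor.map_zero])

end Exact

/-! ### Short exact sequences as triangles in the bounded derived category -/

section Heart

variable (C : Type u₁) [Category.{v₁} C] [Abelian C] [HasDerivedCategory.{w₁} C]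

/-- The canonical t-structure on the bounded derived category. -/
noncomputable abbrev canonicalT : TStructure (DerivedCategory.Bounded C) :=
  (DerivedCategory.TStructure.t (C := C)).onBounded

instance : (incl C).Additive where
  map_add := DerivedCategory.Bounded.ι.map_injective (DerivedCategory.singleFunctor C 0).map_add

variable {C}

lemma interval_iff {a b : ℤ} (X : DerivedCategory.Bounded C) :
    interval (canonicalT C) a b X ↔ interval DerivedCategory.TStructure.t a b X.obj := by
  simp only [interval, ObjectProperty.tStructure_isGE_iff, ObjectProperty.tStructure_isLE_iff]

lemma incl_mem_heart (X : C) : interval (canonicalT C) 0 0 ((incl C).obj X) := by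
  rw [interval_iff]
  exact ⟨inferInstanceAs (((DerivedCategory.singleFunctor C 0).obj X).IsGE 0),
    inferInstanceAs (((DerivedCategory.singleFunctor C 0).obj X).IsLE 0)⟩

lemma heart_le_essImage : interval (canonicalT C) 0 0 ≤ (incl C).essImage := by
  intro X hX
  rw [interval_iff] at hX
  have := hX.1
  have := hX.2
  obtain ⟨Y, ⟨e⟩⟩ := DerivedCategory.exists_iso_singleFunctor_obj_of_isGE_of_isLE X.obj 0
  exact ⟨Y, ⟨DerivedCategory.Bounded.ι.preimageIso e.symm⟩⟩

lemma exists_interval (X : DerivedCategory.Bounded C) :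
    ∃ a b : ℤ, interval (canonicalT C) a b X := by
  obtain ⟨⟨a, ha⟩, b, hb⟩ := X.property
  exact ⟨a, b, (interval_iff X).2 ⟨ha, hb⟩⟩

lemma exists_distTriang_incl {S : ShortComplex C} (hS : S.ShortExact) :
    ∃ δ, Triangle.mk ((incl C).map S.f) ((incl C).map S.g) δ ∈
      distTriang (DerivedCategory.Bounded C) := by
  let ι := DerivedCategory.Bounded.ι (C := C)
  obtain ⟨d, hd⟩ : ∃ d : ι.obj ((incl C).obj S.X₃) ⟶ (ι.obj ((incl C).obj S.X₁))⟦(1 : ℤ)⟧,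
    d = hS.singleδ := ⟨_, rfl⟩
  obtain ⟨δ, hδ⟩ := ι.map_surjective (X := (incl C).obj S.X₃) (Y := ((incl C).obj S.X₁)⟦(1 : ℤ)⟧)
    (d ≫ (ι.commShiftIso (1 : ℤ)).inv.app ((incl C).obj S.X₁))
  refine ⟨δ, (ι.map_distinguished_iff _).1 ?_⟩
  have h : ι.map δ ≫ (ι.commShiftIso (1 : ℤ)).hom.app ((incl C).obj S.X₁) = d := by
    rw [hδ, assoc, Iso.inv_hom_id_app]
    exact comp_id _
  have h' : ι.mapTriangle.obj (Triangle.mk ((incl C).map S.f) ((incl C).map S.g) δ) =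
      hS.singleTriangle := congrArg (Triangle.mk _ _) (h.trans hd)
  rw [h']
  exact hS.singleTriangle_distinguished

lemma incl_hom_shift_eq_zero ⦃X Y : C⦄ ⦃n : ℤ⦄
    (f : (incl C).obj X ⟶ ((incl C).obj Y)⟦n⟧) (hn : n < 0) : f = 0 :=
  have := (incl_mem_heart X).2
  have := ((incl_mem_heart Y).shift n (a' := -n) (b' := -n) (by simp) (by simp)).1
  (canonicalT C).zero f 0 (-n) (by lia)

/-- Vanishing of negative Homs makes the first map a kernel of the second and the second a cokernel
of the first. -/
lemma shortExact_of_distTriang {S : ShortComplex C}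
    {δ : (incl C).obj S.X₃ ⟶ ((incl C).obj S.X₁)⟦(1 : ℤ)⟧}
    (h : Triangle.mk ((incl C).map S.f) ((incl C).map S.g) δ ∈
      distTriang (DerivedCategory.Bounded C)) : S.ShortExact := by
  have h₁ := AbelianSubcategory.isLimitKernelForkOfDistTriang incl_hom_shift_eq_zero S.f S.g δ h
  have h₂ := AbelianSubcategory.isColimitCokernelCoforkOfDistTriang incl_hom_shift_eq_zero
    S.f S.g δ h
  have : Mono S.f := mono_of_isLimit_fork h₁
  have : Epi S.g := epi_of_isColimit_cofork h₂
  exact ⟨S.exact_of_f_is_kernel h₁⟩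

end Heart

/-! ### Exactness and linearity of the restriction -/

section Restriction

variable {C₁ : Type u₁} [Category.{v₁} C₁] [Abelian C₁] [HasDerivedCategory.{w₁} C₁]
  {C₂ : Type u₂} [Category.{v₂} C₂] [Abelian C₂] [HasDerivedCategory.{w₂} C₂]
  (F : DerivedCategory.Bounded C₁ ⥤ DerivedCategory.Bounded C₂)

lemma MapsHeart.interval {F : DerivedCategory.Bounded C₁ ⥤ DerivedCategory.Bounded C₂}
    (hF : MapsHeart F) (X : DerivedCategory.Bounded C₁) (hX : interval (canonicalT C₁) 0 0 X) :
    interval (canonicalT C₂) 0 0 (F.obj X) := by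
  obtain ⟨Y, ⟨e⟩⟩ := heart_le_essImage X hX
  obtain ⟨Z, ⟨e'⟩⟩ := hF Y
  exact (incl_mem_heart Z).of_iso (e' ≪≫ F.mapIso e)

lemma restriction_additive [F.Additive] (hF : MapsHeart F) : (restriction F hF).Additive where
  map_add {X Y f g} := (incl C₂).map_injective (by
    have := Functor.additive_of_iso (restrictionCompInclIso F hF).symm
    exact (restriction F hF ⋙ incl C₂).map_add.trans (incl C₂).map_add.symm)

lemma restriction_linear {K : Type u₀} [Field K] [Linear K C₁] [Linear K C₂]
    [F.Linear K] (hF : MapsHeart F) : (restriction F hF).Linear K where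
  map_smul {X Y} f r := by
    have h₁ : (incl C₁).Linear K := ⟨fun f r => DerivedCategory.Bounded.ι.map_injective
      ((DerivedCategory.singleFunctor C₁ 0).map_smul r f)⟩
    have h₂ : (incl C₂).Linear K := ⟨fun f r => DerivedCategory.Bounded.ι.map_injective
      ((DerivedCategory.singleFunctor C₂ 0).map_smul r f)⟩
    have := Functor.linear_of_iso K (restrictionCompInclIso F hF).symm
    exact (incl C₂).map_injective (((restriction F hF ⋙ incl C₂).map_smul r f).trans
      ((incl C₂).map_smul r _).symm)

variable [F.CommShift ℤ] [F.IsTriangulated] (hF : MapsHeart F)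

lemma restriction_shortExact [(restriction F hF).Additive] (S : ShortComplex C₁)
    (hS : S.ShortExact) : (S.map (restriction F hF)).ShortExact := by
  obtain ⟨δ, hδ⟩ := exists_distTriang_incl hS
  let e := restrictionCompInclIso F hF
  refine shortExact_of_distTriang (δ := e.hom.app S.X₃ ≫
    (F.map δ ≫ (F.commShiftIso (1 : ℤ)).hom.app _) ≫ (e.inv.app S.X₁)⟦(1 : ℤ)⟧')
    (isomorphic_distinguished _ (distTriang_map hδ F) _ ?_)
  refine Triangle.isoMk _ _ (e.app S.X₁) (e.app S.X₂) (e.app S.X₃) (e.hom.naturality S.f)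
    (e.hom.naturality S.g) ?_
  change (e.hom.app S.X₃ ≫ (F.map δ ≫ (F.commShiftIso (1 : ℤ)).hom.app _) ≫
    (e.inv.app S.X₁)⟦(1 : ℤ)⟧') ≫ (e.hom.app S.X₁)⟦(1 : ℤ)⟧' = e.hom.app S.X₃ ≫ _
  simp only [assoc, ← Functor.map_comp, Iso.inv_hom_id_app]
  simp

end Restriction

/-! ### Ample sequences give ample families -/

section AmpleFamily

variable (K : Type u₀) [Field K] {C : Type u₁} [Category.{v₁} C] [Abelian C] [Linear K C]
  [∀ X Y : C, Module.Finite K (X ⟶ Y)] [HasDerivedCategory.{w₁} C]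

/-- The objects in the bounded derived category isomorphic to finite direct sums of `P i`. -/
def finiteSums (P : ℤ → C) (i : ℤ) : ObjectProperty (DerivedCategory.Bounded C) :=
  fun X => ∃ n : ℕ, Nonempty ((incl C).obj (∐ fun _ : Fin n => P i) ≅ X)

variable {K} {P : ℤ → C}

lemma IsAmpleSequence.eventually (hP : IsAmpleSequence K P) (B : C) : ∀ᶠ i in Filter.atBot,
    Epi (evalMorphism K (P i) B) ∧
    (∀ j : ℤ, j ≠ 0 → ∀ f : (incl C).obj (P i) ⟶ ((incl C).obj B)⟦j⟧, f = 0) ∧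
    (∀ f : B ⟶ P i, f = 0) := by
  obtain ⟨i₀, h⟩ := hP B
  exact Filter.eventually_atBot.2 ⟨i₀, h⟩

lemma finiteSums.mem_heart (i : ℤ) (X : DerivedCategory.Bounded C) (h : finiteSums P i X) :
    interval (canonicalT C) 0 0 X := by
  obtain ⟨n, ⟨e⟩⟩ := h
  exact (incl_mem_heart _).of_iso e

lemma finiteSums.from_eq_zero {i : ℤ} {X Y : DerivedCategory.Bounded C} (h : finiteSums P i X)
    (hY : ∀ f : (incl C).obj (P i) ⟶ Y, f = 0) (f : X ⟶ Y) : f = 0 := by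
  obtain ⟨n, ⟨e⟩⟩ := h
  rw [← cancel_epi e.hom, comp_zero]
  refine (isColimitOfPreserves (incl C) (coproductIsCoproduct fun _ : Fin n => P i)).hom_ext
    fun k => ?_
  rw [comp_zero]
  exact hY _

lemma finiteSums.to_eq_zero {i : ℤ} {X : DerivedCategory.Bounded C} (h : finiteSums P i X)
    {B : C} (hB : ∀ f : B ⟶ P i, f = 0) (f : (incl C).obj B ⟶ X) : f = 0 := by
  obtain ⟨n, ⟨e⟩⟩ := h
  rw [← cancel_mono e.inv, zero_comp]
  obtain ⟨g, hg⟩ := (incl C).map_surjective (f ≫ e.inv)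
  rw [← hg]
  have := Abelian.hasFiniteBiproducts (C := C)
  have : g = 0 := by
    rw [← cancel_mono (biproduct.isoCoproduct fun _ : Fin n => P i).inv, zero_comp]
    exact biproduct.hom_ext _ _ fun k => (hB _).trans (hB _).symm
  rw [this, Functor.map_zero]

lemma IsAmpleSequence.isAmpleFamily (hP : IsAmpleSequence K P) :
    IsAmpleFamily (canonicalT C) (finiteSums P) where
  mem_heart := finiteSums.mem_heart
  hom_eq_zero {X} hX := by
    obtain ⟨B, ⟨e⟩⟩ := heart_le_essImage X hX
    filter_upwards [hP.eventually B] with i ⟨_, hi, _⟩ Y hY j hj l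
    rw [← cancel_mono (e.inv⟦j⟧'), zero_comp]
    exact hY.from_eq_zero (hi j hj) _
  exists_triangle {X} hX := by
    obtain ⟨B, ⟨e⟩⟩ := heart_le_essImage X hX
    filter_upwards [hP.eventually B] with i ⟨_, _, _⟩
    have hS : (ShortComplex.mk (kernel.ι (evalMorphism K (P i) B)) (evalMorphism K (P i) B)
      (kernel.condition _)).ShortExact := ⟨ShortComplex.exact_kernel _⟩
    obtain ⟨δ, hδ⟩ := exists_distTriang_incl hS
    exact ⟨_, _, _, _, _, ⟨_, ⟨Iso.refl _⟩⟩,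
      (incl_mem_heart (kernel (evalMorphism K (P i) B))).shift 1 (by lia) (by lia),
      distTriang_of_iso₂ (distTriang_rotate hδ) e⟩

end AmpleFamily

/-! ### Comparison of `F` with the derived functor of its restriction -/

section Main

variable {K : Type u₀} [Field K]
  {A : Type u₁} [Category.{v₁} A] [Abelian A] [Linear K A] [HasDerivedCategory.{w₁} A]
  {B : Type u₂} [Category.{v₂} B] [Abelian B] [HasDerivedCategory.{w₂} B]
  [∀ X Y : A, Module.Finite K (X ⟶ Y)]
  (F : DerivedCategory.Bounded A ⥤ DerivedCategory.Bounded B)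

/-- The functors `F` and `D(G)`, where `G` is the restriction of `F`, agree on the heart. -/
noncomputable def inclCompIso (hF : MapsHeart F) [(restriction F hF).Additive]
    [PreservesFiniteLimits (restriction F hF)] [PreservesFiniteColimits (restriction F hF)] :
    incl A ⋙ F ⋙ DerivedCategory.Bounded.ι ≅
      incl A ⋙ DerivedCategory.Bounded.ι ⋙ (restriction F hF).mapDerivedCategory :=
  Functor.isoWhiskerRight (restrictionCompInclIso F hF).symm DerivedCategory.Bounded.ι ≪≫
    ((restriction F hF).mapDerivedCategorySingleFunctor 0).symm

/-- A triangulated functor between bounded derived categories which has a left adjoint and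
preserves the hearts is induced by its restriction to the hearts, when there is an ample
sequence. -/
theorem nonempty_mapBounded_iso {P : ℤ → A} (hP : IsAmpleSequence K P)
    [F.CommShift ℤ] [F.IsTriangulated] [F.IsRightAdjoint] (hF : MapsHeart F)
    [(restriction F hF).Additive]
    [PreservesFiniteLimits (restriction F hF)] [PreservesFiniteColimits (restriction F hF)] :
    Nonempty (mapBounded (restriction F hF) ≅ F) := by
  let f₀ := LocalIso.ofEssImage (incl A) (inclCompIso F hF) _ heart_le_essImage
  have hV : IsSeparating (canonicalT A) (finiteSums P) (F ⋙ DerivedCategory.Bounded.ι)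
      (DerivedCategory.Bounded.ι ⋙ (restriction F hF).mapDerivedCategory) := by
    refine isSeparating_of_isRightAdjoint (s := canonicalT B) finiteSums.mem_heart
      (fun X hX => ?_) exists_interval hF.interval _ f₀
    obtain ⟨C, ⟨e⟩⟩ := heart_le_essImage X hX
    filter_upwards [hP.eventually C] with i ⟨_, _, hi⟩ Y hY l
    rw [← cancel_epi e.hom, comp_zero]
    exact hY.to_eq_zero hi _
  obtain ⟨e⟩ := LocalIso.nonempty_iso hP.isAmpleFamily.isResolving hV f₀ (fun X Y hX hY l => by
    rw [← cancel_mono (f₀.app Y hY).inv, zero_comp]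
    have hX' := (interval_iff _).1 (hF.interval X hX)
    have hY' := (interval_iff _).1 (hF.interval Y hY)
    have : DerivedCategory.TStructure.t.IsLE
        (((F ⋙ DerivedCategory.Bounded.ι).obj X)⟦(1 : ℤ)⟧) (-1) :=
      (hX'.shift 1 (a' := -1) (b' := -1) (by simp) (by simp)).2
    have : DerivedCategory.TStructure.t.IsGE ((F ⋙ DerivedCategory.Bounded.ι).obj Y) 0 := hY'.1
    exact DerivedCategory.TStructure.t.zero _ (-1) 0 (by simp)) exists_interval
  -- The comparison was made in the unbounded derived category of `B`; full faithfulness of the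
  -- inclusion brings it back.
  exact ⟨Functor.fullyFaithfulCancelRight DerivedCategory.Bounded.ι e.symm⟩

end Main

end BoundedDerived

theorem mainTheorem6 {K : Type u₀} [Field K]
    {A : Type u₁} [Category.{v₁} A] [Abelian A] [Linear K A] [HasDerivedCategory.{w₁} A]
    {B : Type u₂} [Category.{v₂} B] [Abelian B] [Linear K B] [HasDerivedCategory.{w₂} B]
    [∀ X Y : A, Module.Finite K (X ⟶ Y)]
    (hdim : BoundedDerived.FiniteHomologicalDimension A)
    (hample : ∃ P : ℤ → A, BoundedDerived.IsAmpleSequence K P)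
    (F : DerivedCategory.Bounded A ⥤ DerivedCategory.Bounded B)
    [F.CommShift ℤ] [F.IsTriangulated] [F.Linear K] [F.IsRightAdjoint]
    (hF : BoundedDerived.MapsHeart F) :
    ∃ (_ : (BoundedDerived.restriction F hF).Additive)
      (_ : PreservesFiniteLimits (BoundedDerived.restriction F hF))
      (_ : PreservesFiniteColimits (BoundedDerived.restriction F hF)),
      (BoundedDerived.restriction F hF).Linear K ∧
      Nonempty (BoundedDerived.mapBounded (BoundedDerived.restriction F hF) ≅ F) := by
  obtain ⟨P, hP⟩ := hample
  have hadd := BoundedDerived.restriction_additive F hF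
  obtain ⟨hlim, hcolim⟩ := ((BoundedDerived.restriction F hF).exact_tfae.out 0 3 rfl rfl).1
    (BoundedDerived.restriction_shortExact F hF)
  exact ⟨hadd, hlim, hcolim, BoundedDerived.restriction_linear F hF,
    BoundedDerived.nonempty_mapBounded_iso F hP hF⟩
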